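/- All graphs are finite and simple. For a graph $G$ and an integer $k\ge 1$, a set $S\subseteq V(G)$ is $k$-dominating if every vertex of $V(G)\setminus S$ has at least $k$ neighbors in $S$. Two disjoint sets $A,B\subseteq V(G)$ form a $k$-coalition if neither of them is $k$-dominating but $A\cup B$ is $k$-dominating. A $k$-coalition partition of $G$ is a partition of $V(G)$ into nonempty sets, each of which is either a $k$-dominating set of cardinality $k$ or forms a $k$-coalition with another set of the partition. The $k$-coalition number $C_k(G)$ is the maximum cardinality of a $k$-coalition partition of $G$. For every graph $G$ with minimum degree $\delta=\delta(G)\ge 2$ and maximum degree $\Delta=\Delta(G)\ge 4\lfloor \delta/2\rfloor$, $$C_2(G)\le\Big(\Delta-2\Big\lfloor\frac{\delta}{2}\Big\rfloor+1\Big)\Big(\Big\lfloor\frac{\delta}{2}\Big\rfloor+1\Big)+\Big\lceil\frac{\delta}{2}\Big\rceil+1 .$$ Moreover, the bound is sharp: for every integer $d\ge 4$, the graph $G(d)$ defined below has $\delta(G(d))=2$, $\Delta(G(d))=d$ and $C_2(G(d))=2d$, which is the value of the bound for $\delta=2$ and $\Delta=d$. The graph $G(d)$ has the vertices $x$, $y$,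 the vertices $x_i$, $y_i$ for $1\le i\le d$, the vertices $a^i_j$, $c^i_j$ for $1\le i\le d$ and $1\le j\le 4$, and the vertices $b^i_j$ for $2\le i\le d$ and $1\le j\le 4$. Its edges are the following: $x$ is adjacent to $x_1,\dots,x_d$ and $y$ to $y_1,\dots,y_d$; for each $i$, the vertices $a^i_1,a^i_2$ are both adjacent to $a^i_3$ and $a^i_4$, and likewise for $b^i_1,\dots,b^i_4$ (where $i\ge 2$) and for $c^i_1,\dots,c^i_4$, so that each such quadruple induces a 4-cycle; for $1\le i\le d$, $x_i$ is adjacent to $a^i_4$ and $y_i$ to $c^i_1$; and for $2\le i\le d$, $x_i$ is adjacent to $b^i_1$ and $b^i_2$, and $y_i$ to $b^i_3$ and $b^i_4$. -/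

import Mathlib

namespace KCoalition

section Definitions

variable {V : Type*} [DecidableEq V] (G : SimpleGraph V) [DecidableRel G.Adj]

/-- `S` is a `k`-dominating set of `G`: every vertex outside `S` has at least `k` neighbors
in `S`. -/
def IsKDominating (k : ℕ) (S : Finset V) : Prop :=
  ∀ v, v ∉ S → k ≤ (S.filter (fun w => G.Adj v w)).card

/-- The sets `A` and `B` form a `k`-coalition in `G`: they are disjoint, neither of them is
`k`-dominating, and their union is `k`-dominating. -/
def FormKCoalition (k : ℕ) (A B : Finset V) : Prop :=
  Disjoint A B ∧ ¬ IsKDominating G k A ∧ ¬ IsKDominating G k B ∧ IsKDominating G k (A ∪ B)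

variable [Fintype V]

/-- `Θ` is a `k`-coalition partition of `G`: a partition of the vertex set (into nonempty parts)
each of whose parts is a `k`-dominating set of cardinality `k` or forms a `k`-coalition with
another part. -/
def IsKCoalitionPartition (k : ℕ) (Θ : Finpartition (Finset.univ : Finset V)) : Prop :=
  ∀ A ∈ Θ.parts,
    (IsKDominating G k A ∧ A.card = k) ∨ ∃ B ∈ Θ.parts, B ≠ A ∧ FormKCoalition G k A B

/-- The set of the cardinalities of the `k`-coalition partitions of `G`. -/
def partitionCards (k : ℕ) : Set ℕ :=
  {m | ∃ Θ : Finpartition (Finset.univ : Finset V),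
    IsKCoalitionPartition G k Θ ∧ Θ.parts.card = m}

/-- The `k`-coalition number `C_k(G)`: the maximum cardinality of a `k`-coalition partition
of `G` (a maximum by `isGreatest_coalitionNumber`). -/
noncomputable def coalitionNumber (k : ℕ) : ℕ := sSup (partitionCards G k)

end Definitions

section WellDefined

variable {V : Type*} [DecidableEq V] [Fintype V] (G : SimpleGraph V) [DecidableRel G.Adj]

theorem partitionCards_nonempty [Nontrivial V] {k : ℕ} (hk : 2 ≤ k) :
    (partitionCards G k).Nonempty := by
  classical
  have hsing : ∀ v : V, ¬ IsKDominating G k {v} := by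
    intro v h
    obtain ⟨w, hw⟩ := exists_ne v
    have h1 := h w (by simpa using hw)
    have h2 := (Finset.card_filter_le ({v} : Finset V) (fun u => G.Adj w u))
    simp only [Finset.card_singleton] at h2
    omega
  have hemp : ¬ IsKDominating G k (∅ : Finset V) := by
    intro h
    obtain ⟨w, -⟩ := exists_pair_ne V
    have h1 := h w (by simp)
    simp at h1
    omega
  obtain ⟨S, hS, hmax⟩ := Finset.exists_max_image
    ((Finset.univ : Finset (Finset V)).filter (fun S => ¬ IsKDominating G k S)) Finset.card
    ⟨∅, by simpa using hemp⟩
  have hSd : ¬ IsKDominating G k S := by simpa using hS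
  have hadd : ∀ v, v ∉ S → IsKDominating G k (S ∪ {v}) := by
    intro v hv
    by_contra hcon
    have h1 := hmax (S ∪ {v}) (by simpa using hcon)
    rw [Finset.card_union_of_disjoint (by simpa using hv), Finset.card_singleton] at h1
    omega
  have hSne : S.Nonempty := by
    rw [Finset.nonempty_iff_ne_empty]
    rintro rfl
    obtain ⟨w, -⟩ := exists_pair_ne V
    exact hsing w (by simpa using hadd w (by simp))
  have hout : ∃ v, v ∉ S := by
    by_contra hcon
    push Not at hcon
    exact hSd fun v hv => absurd (hcon v) hv
  obtain ⟨v₀, hv₀⟩ := hout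
  let P : Finset (Finset V) := insert S (Sᶜ.image (fun v => ({v} : Finset V)))
  have hP : ∀ A, A ∈ P ↔ A = S ∨ ∃ v, v ∉ S ∧ {v} = A := by
    intro A
    simp [P]
  let Θ : Finpartition (Finset.univ : Finset V) :=
    { parts := P
      supIndep := by
        rw [Finset.supIndep_iff_pairwiseDisjoint]
        intro A hA B hB hAB
        rw [Finset.mem_coe, hP] at hA hB
        rcases hA with rfl | ⟨v, hv, rfl⟩ <;> rcases hB with rfl | ⟨w, hw, rfl⟩
        · exact absurd rfl hAB
        · simpa [Function.onFun] using hw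
        · simpa [Function.onFun] using hv
        · have : v ≠ w := by rintro rfl; exact hAB rfl
          simpa [Function.onFun] using this
      sup_parts := by
        ext v
        simp only [Finset.mem_sup, id, Finset.mem_univ, iff_true]
        by_cases hv : v ∈ S
        · exact ⟨S, (hP S).2 (Or.inl rfl), hv⟩
        · exact ⟨{v}, (hP _).2 (Or.inr ⟨v, hv, rfl⟩), by simp⟩
      bot_notMem := by
        rw [hP]
        rintro (h | ⟨v, -, h⟩)
        · exact hSne.ne_empty h.symm
        · exact Finset.singleton_ne_empty v h }
  refine ⟨_, Θ, ?_, rfl⟩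
  have hne : ∀ v, v ∉ S → ({v} : Finset V) ≠ S := by
    rintro v hv rfl
    simp at hv
  intro A hA
  right
  rcases (hP A).1 hA with rfl | ⟨v, hv, rfl⟩
  · exact ⟨{v₀}, (hP _).2 (Or.inr ⟨v₀, hv₀, rfl⟩), hne v₀ hv₀, by simpa using hv₀, hSd,
      hsing v₀, hadd v₀ hv₀⟩
  · refine ⟨S, (hP S).2 (Or.inl rfl), (hne v hv).symm, by simpa using hv, hsing v, hSd, ?_⟩
    rw [Finset.union_comm]
    exact hadd v hv

theorem partitionCards_bddAbove (k : ℕ) : BddAbove (partitionCards G k) := by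
  refine ⟨Fintype.card V, ?_⟩
  rintro m ⟨Θ, -, rfl⟩
  exact Θ.card_parts_le_card

/-- For `k ≥ 2` and a graph on at least two vertices, `C_k(G)` is the maximum of the cardinalities
of the `k`-coalition partitions. -/
theorem isGreatest_coalitionNumber [Nontrivial V] {k : ℕ} (hk : 2 ≤ k) :
    IsGreatest (partitionCards G k) (coalitionNumber G k) :=
  ⟨Nat.sSup_mem (partitionCards_nonempty G hk) (partitionCards_bddAbove G k),
    fun _ hm => le_csSup (partitionCards_bddAbove G k) hm⟩

end WellDefined

/-- The number `(Δ - 2⌊δ/2⌋ + 1)(⌊δ/2⌋ + 1) + ⌈δ/2⌉ + 1`. It is used only for `Δ ≥ 2⌊δ/2⌋`, so that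
the subtraction does not truncate; `(δ + 1) / 2` is `⌈δ/2⌉`. -/
def bound (δ Δ : ℕ) : ℕ :=
  (Δ - 2 * (δ / 2) + 1) * (δ / 2 + 1) + (δ + 1) / 2 + 1

/-- The vertices of the graph `G(d)`. The index `i = 1, …, d` is represented by
`0, …, d - 1 : Fin d` and the index `j = 1, 2, 3, 4` by `0, 1, 2, 3 : Fin 4`; thus
`a i j` is the vertex `a_{j+1}^{i+1}`, and the `b`-vertices exist only for `i ≠ 0`. -/
inductive SharpVertex (d : ℕ) : Type
  | x : SharpVertex d
  | y : SharpVertex d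
  | xLeaf (i : Fin d) : SharpVertex d
  | yLeaf (i : Fin d) : SharpVertex d
  | a (i : Fin d) (j : Fin 4) : SharpVertex d
  | b (i : {i : Fin d // i.val ≠ 0}) (j : Fin 4) : SharpVertex d
  | c (i : Fin d) (j : Fin 4) : SharpVertex d
  deriving DecidableEq, Fintype

/-- The edges of `G(d)`, each listed in one direction. -/
def sharpRel (d : ℕ) : SharpVertex d → SharpVertex d → Prop
  -- the two stars
  | .x, .xLeaf _ => True
  | .y, .yLeaf _ => True
  -- the 4-cycles, as complete bipartite graphs with parts `{1, 2}` and `{3, 4}`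
  | .a i j, .a i' j' => i = i' ∧ j.val < 2 ∧ 2 ≤ j'.val
  | .b i j, .b i' j' => i = i' ∧ j.val < 2 ∧ 2 ≤ j'.val
  | .c i j, .c i' j' => i = i' ∧ j.val < 2 ∧ 2 ≤ j'.val
  -- the edges between the leaves of the stars and the 4-cycles
  | .xLeaf i, .a i' j => i = i' ∧ j = 3
  | .xLeaf i, .b i' j => i = i'.val ∧ j.val < 2
  | .yLeaf i, .b i' j => i = i'.val ∧ 2 ≤ j.val
  | .yLeaf i, .c i' j => i = i' ∧ j = 0
  | _, _ => False

instance sharpRelDecidable (d : ℕ) : DecidableRel (sharpRel d) := fun u v => by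
  cases u <;> cases v <;> unfold sharpRel <;> infer_instance

/-- The graph `G(d)`. -/
def sharpGraph (d : ℕ) : SimpleGraph (SharpVertex d) :=
  SimpleGraph.fromRel (sharpRel d)

instance sharpGraphDecidable (d : ℕ) : DecidableRel (sharpGraph d).Adj := fun u v =>
  inferInstanceAs (Decidable (u ≠ v ∧ (sharpRel d u v ∨ sharpRel d v u)))

end KCoalition

/-! Fix a vertex `v` of minimum degree. Counting each vertex twice at itself and once at each
neighbor makes 2-domination mean weight at least 2 everywhere, and the parts share weight `deg u +
2` at `u` (`sum_weight_parts`). Split the parts by their weight at `v`: `T` (at least 2), `R` (1),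
`O` (0). The total gives `2|T| + |R| ≤ δ + 2`, and each member of `O` needs its partner in `T`.

To bound `O`, choose `u` at which the most members of `T` have weight at most 1, and let `s` count
the other members of `T`. These already take weight `2s` at `u`, which leaves at most `Δ + 1 - 2s`
partners for the deficient ones together (`card_partners_le`). By maximality the same bound holds
for the partners of each of the `s` others, so `|O| ≤ (s + 1)(Δ + 1 - 2s)`. The assumption on `Δ`
makes `s = ⌊δ/2⌋` the worst case.

For sharpness, `G(d)` is split into two large parts and `2(d - 1)` singletons. -/

namespace KCoalition

/-! ### Upper bound by counting weights. -/

section UpperBound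

variable {V : Type*} [DecidableEq V] (G : SimpleGraph V) [DecidableRel G.Adj]

/-- The weight of `S` at `u`: the number of neighbors of `u` in `S`, plus `2` if `u ∈ S`. -/
def weight (u : V) (S : Finset V) : ℕ :=
  ∑ w ∈ S, if w = u then 2 else if G.Adj u w then 1 else 0

theorem two_le_weight_of_mem {u : V} {S : Finset V} (h : u ∈ S) : 2 ≤ weight G u S := by
  have := Finset.single_le_sum (f := fun w => if w = u then 2 else if G.Adj u w then 1 else 0)
    (fun _ _ => Nat.zero_le _) h
  simpa [weight] using this

theorem weight_of_notMem {u : V} {S : Finset V} (h : u ∉ S) :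
    weight G u S = (S.filter (fun w => G.Adj u w)).card := by
  rw [weight, Finset.card_filter]
  refine Finset.sum_congr rfl fun w hw => ?_
  rw [if_neg (by rintro rfl; exact h hw)]

theorem isKDominating_two_iff {S : Finset V} :
    IsKDominating G 2 S ↔ ∀ u, 2 ≤ weight G u S := by
  refine ⟨fun h u => ?_, fun h u hu => by rw [← weight_of_notMem G hu]; exact h u⟩
  by_cases hu : u ∈ S
  · exact two_le_weight_of_mem G hu
  · rw [weight_of_notMem G hu]; exact h u hu

theorem two_le_weight_add {A B : Finset V} (h : FormKCoalition G 2 A B) (u : V) :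
    2 ≤ weight G u A + weight G u B := by
  have := (isKDominating_two_iff G).1 h.2.2.2 u
  rwa [weight, Finset.sum_union h.1] at this

theorem FormKCoalition.symm {k : ℕ} {A B : Finset V} (h : FormKCoalition G k A B) :
    FormKCoalition G k B A :=
  ⟨h.1.symm, h.2.2.1, h.2.1, Finset.union_comm A B ▸ h.2.2.2⟩

variable [Fintype V]

/-- Each vertex lies in exactly one part: `u` itself contributes 2 and each neighbor contributes 1.
-/
theorem sum_weight_parts (Θ : Finpartition (Finset.univ : Finset V)) (u : V) :
    ∑ S ∈ Θ.parts, weight G u S = G.degree u + 2 := by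
  unfold weight
  rw [← Finset.sum_biUnion (t := fun S => S) Θ.disjoint,
    show Θ.parts.biUnion (fun S => S) = Finset.univ from Θ.biUnion_parts,
    ← Finset.add_sum_erase _ _ (Finset.mem_univ u), if_pos rfl, add_comm,
    ← G.card_neighborFinset_eq_degree, G.neighborFinset_eq_filter, Finset.card_filter,
    ← Finset.add_sum_erase _ _ (Finset.mem_univ u)]
  simp only [SimpleGraph.irrefl, if_false, zero_add, Nat.add_right_cancel_iff]
  exact Finset.sum_congr rfl fun w hw => if_neg (Finset.ne_of_mem_erase hw)

/-- Let `T` and `O` be disjoint families of parts and let `J ≠ ∅` be the family of the members of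
`T` whose weight at `u` is at most `1`. Then few members of `O` have a partner in `J`. -/
theorem card_partners_le (Θ : Finpartition (Finset.univ : Finset V)) {T O J U : Finset (Finset V)}
    (hT : T ⊆ Θ.parts) (hO : O ⊆ Θ.parts) (hTO : Disjoint T O) (u : V)
    (hJ : J = T.filter (fun D => weight G u D ≤ 1)) (hne : J.Nonempty)
    (hU : U ⊆ O) (hUJ : ∀ B ∈ U, ∃ D ∈ J, FormKCoalition G 2 D B)
    (hdeg : 4 * (T.card - 1) ≤ G.maxDegree) :
    U.card + 2 * (T.card - J.card) ≤ G.maxDegree + 1 := by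
  have hJT : J ⊆ T := hJ ▸ Finset.filter_subset _ _
  have hw : ∀ D ∈ T \ J, 2 ≤ weight G u D := by
    intro D hD
    rw [Finset.mem_sdiff, hJ, Finset.mem_filter] at hD
    by_contra hcon
    exact hD.2 ⟨hD.1, by omega⟩
  have hJw : ∀ D ∈ J, weight G u D ≤ 1 := fun D hD => by
    rw [hJ, Finset.mem_filter] at hD
    exact hD.2
  have htot : ∑ D ∈ J, weight G u D + ∑ D ∈ T \ J, weight G u D + ∑ B ∈ U, weight G u B
      ≤ G.maxDegree + 2 := by
    have h1 : ∑ D ∈ J, weight G u D + ∑ D ∈ T \ J, weight G u D = ∑ D ∈ T, weight G u D := by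
      rw [add_comm, Finset.sum_sdiff hJT]
    rw [h1, ← Finset.sum_union (Finset.disjoint_of_subset_right hU hTO)]
    calc _ ≤ ∑ S ∈ Θ.parts, weight G u S :=
          Finset.sum_le_sum_of_subset (Finset.union_subset hT (hU.trans hO))
      _ = G.degree u + 2 := sum_weight_parts G Θ u
      _ ≤ _ := Nat.add_le_add_right (G.degree_le_maxDegree u) 2
  have h2 : 2 * (T.card - J.card) ≤ ∑ D ∈ T \ J, weight G u D := by
    have := Finset.card_nsmul_le_sum (T \ J) (fun D => weight G u D) 2 hw
    rw [Finset.card_sdiff_of_subset hJT, smul_eq_mul] at this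
    omega
  have hJpos := hne.card_pos
  have hJle := Finset.card_le_card hJT
  -- If `J` has no weight at `u`, each partner carries at least 2, and `hdeg` makes the halved count
  -- small enough. Otherwise each partner carries at least 1 and `J` uses up one unit, whence `+ 1`
  -- instead of `+ 2`.
  rcases Nat.eq_zero_or_pos (∑ D ∈ J, weight G u D) with h0 | hpos
  · rw [Finset.sum_eq_zero_iff] at h0
    have := Finset.card_nsmul_le_sum U (fun B => weight G u B) 2 fun B hB => by
      obtain ⟨D, hD, hDB⟩ := hUJ B hB
      have := two_le_weight_add G hDB u
      have := h0 D hD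
      omega
    rw [smul_eq_mul] at this
    omega
  · have := Finset.card_nsmul_le_sum U (fun B => weight G u B) 1 fun B hB => by
      obtain ⟨D, hD, hDB⟩ := hUJ B hB
      have := two_le_weight_add G hDB u
      have := hJw D hD
      omega
    rw [smul_eq_mul] at this
    omega

/-- If every member of `O` has a partner in `T`, then `|O| ≤ (s + 1)(Δ + 1 - 2s)` for some
`s < |T|`. -/
theorem exists_card_le_mul (Θ : Finpartition (Finset.univ : Finset V)) {T O : Finset (Finset V)}
    (hT : T ⊆ Θ.parts) (hO : O ⊆ Θ.parts) (hTO : Disjoint T O) (hTne : T.Nonempty)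
    (hOT : ∀ B ∈ O, ∃ D ∈ T, FormKCoalition G 2 D B)
    (hdeg : 4 * (T.card - 1) ≤ G.maxDegree) :
    ∃ s < T.card, O.card ≤ (s + 1) * (G.maxDegree + 1 - 2 * s) := by
  classical
  rcases O.eq_empty_or_nonempty with rfl | ⟨B₀, hB₀⟩
  · exact ⟨0, hTne.card_pos, by simp⟩
  let J : V → Finset (Finset V) := fun u => T.filter (fun D => weight G u D ≤ 1)
  have hex : ∀ D ∈ T, ∀ B, FormKCoalition G 2 D B → ∃ u, D ∈ J u := by
    intro D hD B h
    have := h.2.1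
    rw [isKDominating_two_iff] at this
    push Not at this
    obtain ⟨u, hu⟩ := this
    exact ⟨u, Finset.mem_filter.2 ⟨hD, by omega⟩⟩
  obtain ⟨D₀, hD₀, h₀⟩ := hOT B₀ hB₀
  obtain ⟨u₀, hu₀⟩ := hex D₀ hD₀ B₀ h₀
  -- Maximality lets the bound at `u` also control the partners of members of `T` outside `J u`.
  obtain ⟨u, -, hmax⟩ := Finset.exists_max_image (Finset.univ : Finset V) (fun u => (J u).card)
    ⟨u₀, Finset.mem_univ _⟩
  have hJpos : 0 < (J u).card :=
    (Finset.card_pos.2 ⟨D₀, hu₀⟩).trans_le (hmax u₀ (Finset.mem_univ _))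
  have hJT : J u ⊆ T := Finset.filter_subset _ _
  have hJle := Finset.card_le_card hJT
  let U : Finset (Finset V) → Finset (Finset V) := fun K =>
    O.filter (fun B => ∃ D ∈ K, FormKCoalition G 2 D B)
  have hU : ∀ u', (J u').Nonempty →
      (U (J u')).card + 2 * (T.card - (J u').card) ≤ G.maxDegree + 1 := fun u' hne =>
    card_partners_le G Θ hT hO hTO u' rfl hne (Finset.filter_subset _ _)
      (fun B hB => (Finset.mem_filter.1 hB).2) hdeg
  refine ⟨T.card - (J u).card, by omega, ?_⟩
  have hsub : O ⊆ U (J u) ∪ (T \ J u).biUnion (fun D => U {D}) := by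
    intro B hB
    obtain ⟨D, hD, h⟩ := hOT B hB
    by_cases hDJ : D ∈ J u
    · exact Finset.mem_union_left _ (Finset.mem_filter.2 ⟨hB, D, hDJ, h⟩)
    · exact Finset.mem_union_right _ (Finset.mem_biUnion.2 ⟨D, Finset.mem_sdiff.2 ⟨hD, hDJ⟩,
        Finset.mem_filter.2 ⟨hB, D, Finset.mem_singleton_self D, h⟩⟩)
  have hsingle : ∀ D ∈ T \ J u,
      (U {D}).card ≤ G.maxDegree + 1 - 2 * (T.card - (J u).card) := by
    intro D hD
    rcases (U {D}).eq_empty_or_nonempty with hemp | ⟨B, hB⟩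
    · rw [hemp]; simp
    obtain ⟨D', hD', h⟩ := (Finset.mem_filter.1 hB).2
    obtain rfl := Finset.mem_singleton.1 hD'
    -- `D'` fails to dominate at some `u'`; as `J u'` is no larger than `J u`, the bound at `u'` is
    -- at least as strong.
    obtain ⟨u', hu'⟩ := hex D' (Finset.mem_sdiff.1 hD).1 B h
    have h1 := hU u' ⟨D', hu'⟩
    have h2 := hmax u' (Finset.mem_univ _)
    have h3 : (U {D'}).card ≤ (U (J u')).card := by
      refine Finset.card_le_card fun B' hB' => ?_
      obtain ⟨hO', E, hE, hEB⟩ := Finset.mem_filter.1 hB'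
      obtain rfl := Finset.mem_singleton.1 hE
      exact Finset.mem_filter.2 ⟨hO', E, hu', hEB⟩
    omega
  have h1 := hU u (Finset.card_pos.1 hJpos)
  have h2 := Finset.card_biUnion_le_card_mul (T \ J u) (fun D => U {D}) _ hsingle
  rw [Finset.card_sdiff_of_subset hJT] at h2
  have h3 := (Finset.card_le_card hsub).trans (Finset.card_union_le _ _)
  rw [Nat.add_mul, one_mul]
  omega

/-- With `f t = (t + 1)(Δ + 1 - 2t)`, the increment `f (t + 1) - f t = Δ - 3 - 4t` is at least 1 for
`t < m`, so `f m - f s ≥ m - s`. -/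
theorem mul_add_le_mul_of_four_mul_le {s m Δ : ℕ} (hs : s ≤ m) (hm : 4 * m ≤ Δ) :
    (s + 1) * (Δ + 1 - 2 * s) + (m - s) ≤ (Δ - 2 * m + 1) * (m + 1) := by
  obtain ⟨c, rfl⟩ := Nat.exists_eq_add_of_le hs
  obtain ⟨e, rfl⟩ := Nat.exists_eq_add_of_le hm
  have h1 : 4 * (s + c) + e + 1 - 2 * s = 2 * s + 4 * c + e + 1 := by omega
  have h2 : 4 * (s + c) + e - 2 * (s + c) = 2 * s + 2 * c + e := by omega
  rw [h1, h2, Nat.add_sub_cancel_left]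
  rcases Nat.eq_zero_or_pos c with rfl | hc
  · nlinarith
  · nlinarith [Nat.mul_le_mul hc hc, Nat.zero_le (c * e), Nat.zero_le (c * s)]

theorem card_parts_le_bound (hδ : 2 ≤ G.minDegree) (hΔ : 4 * (G.minDegree / 2) ≤ G.maxDegree)
    (Θ : Finpartition (Finset.univ : Finset V)) (hΘ : IsKCoalitionPartition G 2 Θ) :
    Θ.parts.card ≤ bound G.minDegree G.maxDegree := by
  classical
  have hV : Nonempty V := by
    by_contra hcon
    rw [not_nonempty_iff] at hcon
    simp at hδ
  obtain ⟨v, hv⟩ := G.exists_minimal_degree_vertex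
  let T := Θ.parts.filter (fun S => 2 ≤ weight G v S)
  let R := Θ.parts.filter (fun S => weight G v S = 1)
  let O := Θ.parts.filter (fun S => weight G v S = 0)
  have hT : T ⊆ Θ.parts := Finset.filter_subset _ _
  have hTR : Disjoint T R := by
    rw [Finset.disjoint_filter]; intros; omega
  have hTO : Disjoint T O := by
    rw [Finset.disjoint_filter]; intros; omega
  have hcard : Θ.parts.card ≤ T.card + R.card + O.card := by
    have : Θ.parts ⊆ (T ∪ R) ∪ O := by
      intro S hS
      simp only [T, R, O, Finset.mem_union, Finset.mem_filter, hS, true_and]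
      omega
    exact (Finset.card_le_card this).trans ((Finset.card_union_le _ _).trans
      (Nat.add_le_add_right (Finset.card_union_le _ _) _))
  have hTne : T.Nonempty := by
    have hmem : v ∈ Finset.univ (α := V) := Finset.mem_univ v
    rw [← Θ.biUnion_parts, Finset.mem_biUnion] at hmem
    obtain ⟨S, hS, hvS⟩ := hmem
    exact ⟨S, Finset.mem_filter.2 ⟨hS, two_le_weight_of_mem G hvS⟩⟩
  have hsum : 2 * T.card + R.card ≤ G.minDegree + 2 := by
    have h1 := Finset.card_nsmul_le_sum T (fun S => weight G v S) 2
      fun S hS => (Finset.mem_filter.1 hS).2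
    have h2 := Finset.card_nsmul_le_sum R (fun S => weight G v S) 1
      fun S hS => (Finset.mem_filter.1 hS).2.ge
    have h3 : ∑ S ∈ T ∪ R, weight G v S ≤ ∑ S ∈ Θ.parts, weight G v S :=
      Finset.sum_le_sum_of_subset (Finset.union_subset hT (Finset.filter_subset _ _))
    rw [Finset.sum_union hTR, sum_weight_parts, ← hv] at h3
    simp only [smul_eq_mul] at h1 h2
    omega
  have hOT : ∀ B ∈ O, ∃ D ∈ T, FormKCoalition G 2 D B := by
    intro B hB
    obtain ⟨hBΘ, hB0⟩ := Finset.mem_filter.1 hB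
    rcases hΘ B hBΘ with ⟨hdom, -⟩ | ⟨D, hD, -, h⟩
    · have := (isKDominating_two_iff G).1 hdom v
      omega
    · have := two_le_weight_add G h v
      exact ⟨D, Finset.mem_filter.2 ⟨hD, by omega⟩, h.symm⟩
  have hTpos := hTne.card_pos
  obtain ⟨s, hs, hle⟩ := exists_card_le_mul G Θ (O := O) hT (Finset.filter_subset _ _) hTO hTne hOT
    (by omega)
  -- Since `|T| ≥ s + 1`, `hsum` gives `|T| + |R| ≤ (⌊δ/2⌋ - s) + ⌈δ/2⌉ + 1`; the bracket is the
  -- extra summand absorbed here.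
  have hfin := mul_add_le_mul_of_four_mul_le (s := s) (by omega) hΔ
  unfold bound
  omega

theorem coalitionNumber_two_le_bound (hδ : 2 ≤ G.minDegree)
    (hΔ : 4 * (G.minDegree / 2) ≤ G.maxDegree) :
    coalitionNumber G 2 ≤ bound G.minDegree G.maxDegree :=
  csSup_le' fun _ ⟨Θ, hΘ, h⟩ => h ▸ card_parts_le_bound G hδ hΔ Θ hΘ

end UpperBound

/-! ### Partitions given by labelings. -/

section Fibers

variable {V ι : Type*} [DecidableEq V] [Fintype V] [DecidableEq ι] [Fintype ι]

/-- The partition of a finite type into the fibers of a surjective map. -/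
def fiberPartition (f : V → ι) (hf : Function.Surjective f) :
    Finpartition (Finset.univ : Finset V) where
  parts := Finset.univ.image fun i => Finset.univ.filter fun v => f v = i
  supIndep := by
    rw [Finset.supIndep_iff_pairwiseDisjoint]
    intro A hA B hB hAB
    simp only [Finset.coe_image, Finset.coe_univ, Set.image_univ, Set.mem_range] at hA hB
    obtain ⟨i, rfl⟩ := hA
    obtain ⟨j, rfl⟩ := hB
    refine Finset.disjoint_filter.2 fun v _ hi hj => hAB ?_
    rw [← hi, ← hj]
  sup_parts := by
    ext v
    simp
  bot_notMem := by
    intro h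
    obtain ⟨i, -, hi⟩ := Finset.mem_image.1 h
    obtain ⟨v, rfl⟩ := hf i
    have : v ∈ (⊥ : Finset V) := hi ▸ Finset.mem_filter.2 ⟨Finset.mem_univ v, rfl⟩
    simp at this

theorem card_parts_fiberPartition (f : V → ι) (hf : Function.Surjective f) :
    (fiberPartition f hf).parts.card = Fintype.card ι := by
  refine Finset.card_image_of_injective _ fun i j hij => ?_
  obtain ⟨v, rfl⟩ := hf i
  have : v ∈ Finset.univ.filter fun w => f w = f v := by simp
  rw [show (Finset.univ.filter fun w => f w = f v) = _ from hij] at this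
  simpa using this

end Fibers

/-! ### The extremal graphs `G(d)`. -/

section Sharpness

variable {d : ℕ}

theorem isKDominating_two_of_exists {V : Type*} [DecidableEq V] {G : SimpleGraph V}
    [DecidableRel G.Adj] {S : Finset V}
    (h : ∀ v, v ∉ S → ∃ p q, p ≠ q ∧ p ∈ S ∧ q ∈ S ∧ G.Adj v p ∧ G.Adj v q) :
    IsKDominating G 2 S := by
  intro v hv
  obtain ⟨p, q, hpq, hp, hq, hvp, hvq⟩ := h v hv
  exact Finset.one_lt_card.2 ⟨p, by simp [hp, hvp], q, by simp [hq, hvq], hpq⟩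

theorem not_isKDominating_two {V : Type*} [DecidableEq V] {G : SimpleGraph V}
    [DecidableRel G.Adj] {S : Finset V} (v p : V) (hv : v ∉ S)
    (h : ∀ w ∈ S, G.Adj v w → w = p) : ¬ IsKDominating G 2 S := by
  intro hdom
  obtain ⟨a, ha, b, hb, hab⟩ := Finset.one_lt_card.1 (hdom v hv)
  rw [Finset.mem_filter] at ha hb
  exact hab ((h a ha.1 ha.2).trans (h b hb.1 hb.2).symm)

/-- The labels of the parts of an optimal partition of `G(d)`: two large parts, labelled by the
elements of `Bool`, and the singletons of the vertices `x_i` and `y_i` with `i ≠ 1`. -/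
abbrev SharpLabel (d : ℕ) : Type := Bool ⊕ (Bool × {i : Fin d // i.val ≠ 0})

/-- The label of the part of a vertex of `G(d)`. -/
def sharpLabel (d : ℕ) : SharpVertex d → SharpLabel d
  | .x => .inl true
  | .y => .inl false
  | .xLeaf i => if h : i.val = 0 then .inl false else .inr (false, ⟨i, h⟩)
  | .yLeaf i => if h : i.val = 0 then .inl true else .inr (true, ⟨i, h⟩)
  | .a _ j => .inl (decide (2 ≤ j.val))
  | .b _ j => .inl (decide (2 ≤ j.val))
  | .c _ j => .inl (decide (2 ≤ j.val))

theorem sharpLabel_surjective : Function.Surjective (sharpLabel d) := by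
  rintro ((_ | _) | ⟨_ | _, i⟩)
  · exact ⟨.y, rfl⟩
  · exact ⟨.x, rfl⟩
  · exact ⟨.xLeaf i, by simp [sharpLabel, i.2]⟩
  · exact ⟨.yLeaf i, by simp [sharpLabel, i.2]⟩

theorem card_sharpLabel (hd : 0 < d) : Fintype.card (SharpLabel d) = 2 * d := by
  obtain ⟨n, rfl⟩ := Nat.exists_eq_succ_of_ne_zero hd.ne'
  have : Fintype.card {i : Fin (n + 1) // i.val ≠ 0} = n := by
    have h := Fintype.card_subtype_compl (fun i : Fin (n + 1) => i = 0)
    simp only [Fintype.card_fin, Fintype.card_subtype_eq, Nat.add_sub_cancel] at h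
    refine Eq.trans ?_ h
    exact Fintype.card_congr (Equiv.subtypeEquivRight fun i => not_congr Fin.val_eq_zero_iff :
      {i : Fin (n + 1) // i.val ≠ 0} ≃ {i : Fin (n + 1) // ¬i = 0})
  rw [Fintype.card_sum, Fintype.card_prod, this]
  simp
  omega

/-- The part with a given label. -/
abbrev sharpPart (d : ℕ) (l : SharpLabel d) : Finset (SharpVertex d) :=
  Finset.univ.filter fun v => sharpLabel d v = l

/-- Each large part fails at the star center it omits, whose only neighbor in it is the leaf with
index 0. Each singleton fails at the center of the other star, which has no neighbor in it. -/
theorem not_isKDominating_sharpPart (hd : 0 < d) (l : SharpLabel d) :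
    ¬ IsKDominating (sharpGraph d) 2 (sharpPart d l) := by
  rcases l with (_ | _) | ⟨_ | _, i⟩
  · refine not_isKDominating_two .x (.xLeaf ⟨0, hd⟩) (by simp [sharpLabel]) fun w hw h => ?_
    cases w <;> simp_all [sharpGraph, sharpRel, sharpLabel, Fin.ext_iff]
  · refine not_isKDominating_two .y (.yLeaf ⟨0, hd⟩) (by simp [sharpLabel]) fun w hw h => ?_
    cases w <;> simp_all [sharpGraph, sharpRel, sharpLabel, Fin.ext_iff]
  · refine not_isKDominating_two .y .y (by simp [sharpLabel]) fun w hw h => ?_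
    cases w <;> simp_all [sharpGraph, sharpRel, sharpLabel]
    split at hw <;> simp at hw
  · refine not_isKDominating_two .x .x (by simp [sharpLabel]) fun w hw h => ?_
    cases w <;> simp_all [sharpGraph, sharpRel, sharpLabel]
    split at hw <;> simp at hw

/-- The singleton supplies the missing second neighbor of the omitted center. Every other vertex
outside is already served by the large part: leaves of the omitted center by two `b`-vertices,
leaves of the other star by their center and an `a`- or `c`-vertex, and 4-cycle vertices by the
opposite pair. -/
theorem formKCoalition_sharpPart (hd : 0 < d) (e : Bool) (i : {i : Fin d // i.val ≠ 0}) :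
    FormKCoalition (sharpGraph d) 2 (sharpPart d (.inl e)) (sharpPart d (.inr (e, i))) := by
  refine ⟨Finset.disjoint_filter.2 fun v _ h1 h2 => by simp [h1] at h2,
    not_isKDominating_sharpPart hd _, not_isKDominating_sharpPart hd _,
    isKDominating_two_of_exists fun v hv => ?_⟩
  rcases e with _ | _
  · cases v with
    | x => exact ⟨.xLeaf ⟨0, hd⟩, .xLeaf i, by
        simpa [Fin.ext_iff] using Ne.symm i.2, by
        simp [sharpGraph, sharpRel, sharpLabel, i.2]⟩
    | y => simp [sharpLabel] at hv
    | xLeaf j =>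
      have hj : j.val ≠ 0 := fun h => by simp [sharpLabel, h] at hv
      exact ⟨.b ⟨j, hj⟩ 0, .b ⟨j, hj⟩ 1, by simp, by simp [sharpGraph, sharpRel, sharpLabel]⟩
    | yLeaf j => exact ⟨.y, .c j 0, by simp, by simp [sharpGraph, sharpRel, sharpLabel]⟩
    | a j k =>
      have hk : 2 ≤ k.val := by simpa [sharpLabel, Nat.succ_le_iff] using hv
      exact ⟨.a j 0, .a j 1, by simp, by simp [sharpGraph, sharpRel, sharpLabel, hk]; grind⟩
    | b j k =>
      have hk : 2 ≤ k.val := by simpa [sharpLabel, Nat.succ_le_iff] using hv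
      exact ⟨.b j 0, .b j 1, by simp, by simp [sharpGraph, sharpRel, sharpLabel, hk]; grind⟩
    | c j k =>
      have hk : 2 ≤ k.val := by simpa [sharpLabel, Nat.succ_le_iff] using hv
      exact ⟨.c j 0, .c j 1, by simp, by simp [sharpGraph, sharpRel, sharpLabel, hk]; grind⟩
  · cases v with
    | y => exact ⟨.yLeaf ⟨0, hd⟩, .yLeaf i, by
        simpa [Fin.ext_iff] using Ne.symm i.2, by
        simp [sharpGraph, sharpRel, sharpLabel, i.2]⟩
    | x => simp [sharpLabel] at hv
    | yLeaf j =>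
      have hj : j.val ≠ 0 := fun h => by simp [sharpLabel, h] at hv
      exact ⟨.b ⟨j, hj⟩ 2, .b ⟨j, hj⟩ 3, by simp, by simp [sharpGraph, sharpRel, sharpLabel]⟩
    | xLeaf j => exact ⟨.x, .a j 3, by simp, by simp [sharpGraph, sharpRel, sharpLabel]⟩
    | a j k =>
      have hk : k.val < 2 := by simpa [sharpLabel] using hv
      exact ⟨.a j 2, .a j 3, by simp, by simp [sharpGraph, sharpRel, sharpLabel, hk]; grind⟩
    | b j k =>
      have hk : k.val < 2 := by simpa [sharpLabel] using hv
      exact ⟨.b j 2, .b j 3, by simp, by simp [sharpGraph, sharpRel, sharpLabel, hk]; grind⟩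
    | c j k =>
      have hk : k.val < 2 := by simpa [sharpLabel] using hv
      exact ⟨.c j 2, .c j 3, by simp, by simp [sharpGraph, sharpRel, sharpLabel, hk]; grind⟩

theorem two_mul_le_coalitionNumber_sharpGraph (hd : 2 ≤ d) :
    2 * d ≤ coalitionNumber (sharpGraph d) 2 := by
  have hd0 : 0 < d := by omega
  refine le_csSup (partitionCards_bddAbove _ 2)
    ⟨fiberPartition (sharpLabel d) sharpLabel_surjective, fun A hA => Or.inr ?_,
      (card_parts_fiberPartition _ _).trans (card_sharpLabel hd0)⟩
  have hmem : ∀ l, sharpPart d l ∈ (fiberPartition (sharpLabel d) sharpLabel_surjective).parts :=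
    fun l => Finset.mem_image_of_mem _ (Finset.mem_univ l)
  have hne : ∀ l l', l ≠ l' → sharpPart d l ≠ sharpPart d l' := by
    intro l l' hl h
    obtain ⟨v, rfl⟩ := sharpLabel_surjective l
    have : v ∈ sharpPart d (sharpLabel d v) := by simp
    rw [h] at this
    exact hl (by simpa using this)
  obtain ⟨l, -, rfl⟩ := Finset.mem_image.1 hA
  rcases l with e | ⟨e, i⟩
  · exact ⟨sharpPart d (.inr (e, ⟨⟨1, hd⟩, one_ne_zero⟩)), hmem _, hne _ _ (by simp),
      formKCoalition_sharpPart hd0 e _⟩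
  · exact ⟨sharpPart d (.inl e), hmem _, hne _ _ (by simp),
      (formKCoalition_sharpPart hd0 e i).symm⟩

theorem two_le_degree_sharpGraph (hd : 2 ≤ d) (v : SharpVertex d) :
    2 ≤ (sharpGraph d).degree v := by
  suffices h : ∃ p q, p ≠ q ∧ (sharpGraph d).Adj v p ∧ (sharpGraph d).Adj v q by
    obtain ⟨p, q, hpq, hp, hq⟩ := h
    exact Finset.one_lt_card.2 ⟨p, by simpa using hp, q, by simpa using hq, hpq⟩
  have hd0 : 0 < d := by omega
  cases v with
  | x => exact ⟨.xLeaf ⟨0, hd0⟩, .xLeaf ⟨1, hd⟩, by simp, by simp [sharpGraph, sharpRel]⟩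
  | y => exact ⟨.yLeaf ⟨0, hd0⟩, .yLeaf ⟨1, hd⟩, by simp, by simp [sharpGraph, sharpRel]⟩
  | xLeaf j => exact ⟨.x, .a j 3, by simp, by simp [sharpGraph, sharpRel]⟩
  | yLeaf j => exact ⟨.y, .c j 0, by simp, by simp [sharpGraph, sharpRel]⟩
  | a j k =>
    rcases lt_or_ge k.val 2 with hk | hk
    · exact ⟨.a j 2, .a j 3, by simp, by simp [sharpGraph, sharpRel, hk]; grind⟩
    · exact ⟨.a j 0, .a j 1, by simp, by simp [sharpGraph, sharpRel, hk]; grind⟩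
  | b j k =>
    rcases lt_or_ge k.val 2 with hk | hk
    · exact ⟨.b j 2, .b j 3, by simp, by simp [sharpGraph, sharpRel, hk]; grind⟩
    · exact ⟨.b j 0, .b j 1, by simp, by simp [sharpGraph, sharpRel, hk]; grind⟩
  | c j k =>
    rcases lt_or_ge k.val 2 with hk | hk
    · exact ⟨.c j 2, .c j 3, by simp, by simp [sharpGraph, sharpRel, hk]; grind⟩
    · exact ⟨.c j 0, .c j 1, by simp, by simp [sharpGraph, sharpRel, hk]; grind⟩

theorem degree_le_card_of_forall_mem {V : Type*} [Fintype V] [DecidableEq V] {G : SimpleGraph V}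
    [DecidableRel G.Adj] {v : V} (S : Finset V) (h : ∀ w, G.Adj v w → w ∈ S) :
    G.degree v ≤ S.card :=
  Finset.card_le_card fun w hw => h w (by simpa using hw)

theorem minDegree_sharpGraph (hd : 2 ≤ d) : (sharpGraph d).minDegree = 2 := by
  have : Nonempty (SharpVertex d) := ⟨.x⟩
  refine le_antisymm ?_ ((sharpGraph d).le_minDegree_of_forall_le_degree 2
    (two_le_degree_sharpGraph hd))
  -- There is no `b`-cycle at index 0, so this leaf has degree only 2.
  refine ((sharpGraph d).minDegree_le_degree (.xLeaf ⟨0, by omega⟩)).trans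
    ((degree_le_card_of_forall_mem {.x, .a ⟨0, by omega⟩ 3} fun w hw => ?_).trans
      Finset.card_le_two)
  cases w <;> simp_all [sharpGraph, sharpRel]
  grind

theorem degree_sharpGraph_x : (sharpGraph d).degree .x = d := by
  have : (sharpGraph d).neighborFinset .x = Finset.univ.image SharpVertex.xLeaf := by
    ext w
    rw [SimpleGraph.mem_neighborFinset]
    cases w <;> simp [sharpGraph, sharpRel]
  rw [SimpleGraph.degree, this, Finset.card_image_of_injective _ fun i j h => by simpa using h]
  simp

theorem degree_sharpGraph_y : (sharpGraph d).degree .y = d := by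
  have : (sharpGraph d).neighborFinset .y = Finset.univ.image SharpVertex.yLeaf := by
    ext w
    rw [SimpleGraph.mem_neighborFinset]
    cases w <;> simp [sharpGraph, sharpRel]
  rw [SimpleGraph.degree, this, Finset.card_image_of_injective _ fun i j h => by simpa using h]
  simp

/-- All vertices but the two centers have degree at most 4, attained by the leaves of nonzero index;
hence `4 ≤ d`. Lists of fewer than four neighbors are padded by repetition. -/
theorem degree_sharpGraph_le (hd : 4 ≤ d) (v : SharpVertex d) : (sharpGraph d).degree v ≤ d := by
  suffices h : v = .x ∨ v = .y ∨ ∃ p q r s : SharpVertex d, ∀ w, (sharpGraph d).Adj v w →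
      w = p ∨ w = q ∨ w = r ∨ w = s by
    rcases h with rfl | rfl | ⟨p, q, r, s, h⟩
    · exact degree_sharpGraph_x.le
    · exact degree_sharpGraph_y.le
    · exact ((degree_le_card_of_forall_mem {p, q, r, s} (by simpa using h)).trans
        Finset.card_le_four).trans hd
  cases v with
  | x => exact .inl rfl
  | y => exact .inr (.inl rfl)
  | xLeaf i =>
    refine .inr (.inr ?_)
    by_cases hi : i.val = 0
    · refine ⟨.x, .a i 3, .x, .x, fun w hw => ?_⟩
      cases w <;> simp_all [sharpGraph, sharpRel]
      grind
    · refine ⟨.x, .a i 3, .b ⟨i, hi⟩ 0, .b ⟨i, hi⟩ 1, fun w hw => ?_⟩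
      cases w <;> simp_all [sharpGraph, sharpRel]
      grind
  | yLeaf i =>
    refine .inr (.inr ?_)
    by_cases hi : i.val = 0
    · refine ⟨.y, .c i 0, .y, .y, fun w hw => ?_⟩
      cases w <;> simp_all [sharpGraph, sharpRel]
      grind
    · refine ⟨.y, .c i 0, .b ⟨i, hi⟩ 2, .b ⟨i, hi⟩ 3, fun w hw => ?_⟩
      cases w <;> simp_all [sharpGraph, sharpRel]
      grind
  | a i j =>
    refine .inr (.inr ?_)
    rcases lt_or_ge j.val 2 with hj | hj
    · refine ⟨.a i 2, .a i 3, .a i 2, .a i 2, fun w hw => ?_⟩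
      cases w <;> simp_all [sharpGraph, sharpRel]
      grind
    · refine ⟨.xLeaf i, .a i 0, .a i 1, .a i 1, fun w hw => ?_⟩
      cases w <;> simp_all [sharpGraph, sharpRel]
      grind
  | b i j =>
    refine .inr (.inr ?_)
    rcases lt_or_ge j.val 2 with hj | hj
    · refine ⟨.xLeaf i, .b i 2, .b i 3, .b i 2, fun w hw => ?_⟩
      cases w <;> simp_all [sharpGraph, sharpRel] <;> grind
    · refine ⟨.yLeaf i, .b i 0, .b i 1, .b i 1, fun w hw => ?_⟩
      cases w <;> simp_all [sharpGraph, sharpRel] <;> grind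
  | c i j =>
    refine .inr (.inr ?_)
    rcases lt_or_ge j.val 2 with hj | hj
    · refine ⟨.yLeaf i, .c i 2, .c i 3, .c i 2, fun w hw => ?_⟩
      cases w <;> simp_all [sharpGraph, sharpRel]
      grind
    · refine ⟨.c i 0, .c i 1, .c i 1, .c i 1, fun w hw => ?_⟩
      cases w <;> simp_all [sharpGraph, sharpRel]
      grind

theorem maxDegree_sharpGraph (hd : 4 ≤ d) : (sharpGraph d).maxDegree = d := by
  refine le_antisymm ((sharpGraph d).maxDegree_le_of_forall_degree_le d (degree_sharpGraph_le hd)) ?_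
  exact degree_sharpGraph_x.ge.trans ((sharpGraph d).degree_le_maxDegree .x)

theorem bound_two {d : ℕ} (hd : 2 ≤ d) : bound 2 d = 2 * d := by
  simp only [bound]
  omega

theorem coalitionNumber_sharpGraph (hd : 4 ≤ d) :
    coalitionNumber (sharpGraph d) 2 = 2 * d := by
  refine le_antisymm ?_ (two_mul_le_coalitionNumber_sharpGraph (by omega))
  have hmin : (sharpGraph d).minDegree = 2 := minDegree_sharpGraph (by omega)
  have h := coalitionNumber_two_le_bound (sharpGraph d) hmin.ge
    (by rw [hmin, maxDegree_sharpGraph hd]; omega)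
  rwa [hmin, maxDegree_sharpGraph hd, bound_two (by omega)] at h

end Sharpness

end KCoalition

theorem mainTheorem1 :
    (∀ {V : Type*} [Fintype V] [DecidableEq V] (G : SimpleGraph V) [DecidableRel G.Adj],
      2 ≤ G.minDegree → 4 * (G.minDegree / 2) ≤ G.maxDegree →
        KCoalition.coalitionNumber G 2 ≤ KCoalition.bound G.minDegree G.maxDegree) ∧
    (∀ d : ℕ, 4 ≤ d →
      (KCoalition.sharpGraph d).minDegree = 2 ∧
      (KCoalition.sharpGraph d).maxDegree = d ∧
      KCoalition.coalitionNumber (KCoalition.sharpGraph d) 2 = 2 * d ∧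
      KCoalition.coalitionNumber (KCoalition.sharpGraph d) 2 =
        KCoalition.bound (KCoalition.sharpGraph d).minDegree
          (KCoalition.sharpGraph d).maxDegree) := by
  refine ⟨fun G _ => KCoalition.coalitionNumber_two_le_bound G, fun d hd => ?_⟩
  have hmin := KCoalition.minDegree_sharpGraph (d := d) (by omega)
  have hmax := KCoalition.maxDegree_sharpGraph hd
  have hC := KCoalition.coalitionNumber_sharpGraph hd
  exact ⟨hmin, hmax, hC, by rw [hC, hmin, hmax, KCoalition.bound_two (by omega)]⟩
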